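/- Let $K$ be a field of characteristic $0$, let $\mathcal G$ be a finite-dimensional Lie algebra over $K$, and let $\mathcal S$ be a finite commutative semigroup. The $\mathcal S$-expansion $\mathcal G_{\mathcal S}=\mathcal S\otimes\mathcal G$ is the Lie algebra $\bigoplus_{\alpha\in\mathcal S}\alpha\otimes\mathcal G$ with bracket determined by $[\alpha\otimes x,\beta\otimes y]=(\alpha\beta)\otimes[x,y]$; for a subspace $V\subseteq\mathcal G$, $\mathcal S\otimes V$ denotes the span of all $\alpha\otimes x$ with $\alpha\in\mathcal S$, $x\in V$. Write $A=I\uplus B$ if $A$ is the vector space direct sum of an ideal $I$ of $A$ and a subalgebra $B$ of $A$. A Levi–Malcev decomposition of a finite-dimensional Lie algebra $L$ is a decomposition $L=N\uplus S$ in which $N$ is the radical of $L$ (its largest solvable ideal) and $S$ is a semisimple subalgebra (its Killing form is nondegenerate). Let $\mathcal G=N\uplus S$ be a Levi–Malcev decomposition, and put $E_N=\mathcal S\otimes N$ and $E_S=\mathcal S\otimes S$. Then: 1. $E_N$ is an ideal and $E_S$ is a subalgebra of $\mathcal G_{\mathcal S}$, and $\mathcal G_{\mathcal S}=E_N\uplus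 E_S$. 2. $E_S$ has a Levi–Malcev decomposition. 3. For every Levi–Malcev decomposition $E_S=N'\uplus S_{\exp}$ (so $N'$ is the radical of $E_S$ and $S_{\exp}$ is semisimple), the radical $N_{\exp}$ of $\mathcal G_{\mathcal S}$ satisfies $N_{\exp}=E_N\uplus N'$, and $\mathcal G_{\mathcal S}=N_{\exp}\uplus S_{\exp}$ is a Levi–Malcev decomposition of $\mathcal G_{\mathcal S}$. -/

import Mathlib

/-- The expansion `𝒮 ⊗ L` of a Lie algebra `L` by a commutative semigroup `𝒮`: the finitely
supported families of elements of `L` indexed by `𝒮`, where `Finsupp.single α x` plays the role of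
`α ⊗ x`.  As a module it is the direct sum of the copies `α ⊗ L`, `α ∈ 𝒮`. -/
def SExpansion (𝒮 L : Type*) [Zero L] : Type _ := 𝒮 →₀ L

namespace SExpansion

noncomputable section

section Module

variable {𝒮 L : Type*} [LieRing L]

instance : AddCommGroup (SExpansion 𝒮 L) := inferInstanceAs (AddCommGroup (𝒮 →₀ L))

instance {K : Type*} [CommRing K] [LieAlgebra K L] : Module K (SExpansion 𝒮 L) :=
  inferInstanceAs (Module K (𝒮 →₀ L))

/-- The generator `α ⊗ x` of the expansion. -/
def tmul (α : 𝒮) (x : L) : SExpansion 𝒮 L := Finsupp.single α x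

/-- The coordinates of an element of the expansion: `f = ∑ α, α ⊗ (f.coeff α)`. -/
def coeff (f : SExpansion 𝒮 L) : 𝒮 →₀ L := f

theorem induction {p : SExpansion 𝒮 L → Prop} (f : SExpansion 𝒮 L) (h0 : p 0)
    (hadd : ∀ f g, p f → p g → p (f + g)) (hs : ∀ α x, p (tmul α x)) : p f :=
  Finsupp.induction_linear (motive := p) f h0 hadd hs

theorem tmul_zero (α : 𝒮) : tmul α (0 : L) = 0 := Finsupp.single_zero α

theorem tmul_add (α : 𝒮) (x y : L) : tmul α (x + y) = tmul α x + tmul α y :=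
  Finsupp.single_add α x y

theorem tmul_neg (α : 𝒮) (x : L) : tmul α (-x) = -tmul α x := Finsupp.single_neg α x

theorem tmul_smul {K : Type*} [CommRing K] [LieAlgebra K L] (t : K) (α : 𝒮) (x : L) :
    tmul α (t • x) = t • tmul α x := (Finsupp.smul_single t α x).symm

variable {K : Type*} [CommRing K] [LieAlgebra K L]

variable (𝒮) in
/-- The subspace `𝒮 ⊗ V` of `𝒮 ⊗ L`, for a subspace `V` of `L`: the elements all of whose
coordinates lie in `V`. -/
def ofSubmodule (V : Submodule K L) : Submodule K (SExpansion 𝒮 L) where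
  carrier := {f | ∀ α, f.coeff α ∈ V}
  add_mem' hf hg α := V.add_mem (hf α) (hg α)
  zero_mem' _ := V.zero_mem
  smul_mem' t _ hf α := V.smul_mem t (hf α)

/-- `𝒮 ⊗ V` is the linear span of the generators `α ⊗ x` with `x ∈ V`. -/
theorem ofSubmodule_eq_span (V : Submodule K L) :
    ofSubmodule 𝒮 V = Submodule.span K {f | ∃ α : 𝒮, ∃ x ∈ V, f = tmul α x} := by
  apply le_antisymm
  · intro f hf
    have : f = Finsupp.sum f.coeff fun α x => tmul α x := (Finsupp.sum_single f.coeff).symm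
    rw [this]
    exact Submodule.sum_mem _ fun α _ => Submodule.subset_span ⟨α, _, hf α, rfl⟩
  · rw [Submodule.span_le]
    rintro _ ⟨α, x, hx, rfl⟩ β
    classical
    have : (tmul α x).coeff β = if α = β then x else 0 := Finsupp.single_apply
    rw [this]
    split_ifs
    · exact hx
    · exact V.zero_mem

end Module

variable {𝒮 L : Type*} [CommSemigroup 𝒮] [LieRing L]

/-- The bracket, the biadditive extension of `⁅α ⊗ x, β ⊗ y⁆ = (α * β) ⊗ ⁅x, y⁆`. -/
instance : Bracket (SExpansion 𝒮 L) (SExpansion 𝒮 L) where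
  bracket f g := f.coeff.sum fun α x => g.coeff.sum fun β y => tmul (α * β) ⁅x, y⁆

protected theorem add_lie (f g h : SExpansion 𝒮 L) : ⁅f + g, h⁆ = ⁅f, h⁆ + ⁅g, h⁆ := by
  refine Finsupp.sum_add_index' (fun α => ?_) (fun α x y => ?_)
  · simp only [zero_lie, tmul_zero]
    exact Finset.sum_const_zero
  · simp only [add_lie, tmul_add]
    exact Finsupp.sum_add

protected theorem lie_add (f g h : SExpansion 𝒮 L) : ⁅f, g + h⁆ = ⁅f, g⁆ + ⁅f, h⁆ := by
  refine Eq.trans ?_ Finsupp.sum_add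
  refine Finsupp.sum_congr fun α _ => ?_
  refine Finsupp.sum_add_index' (fun β => ?_) (fun β x y => ?_)
  · rw [lie_zero, tmul_zero]
  · rw [lie_add, tmul_add]

protected theorem zero_lie (f : SExpansion 𝒮 L) : ⁅(0 : SExpansion 𝒮 L), f⁆ = 0 :=
  Finsupp.sum_zero_index

protected theorem lie_zero (f : SExpansion 𝒮 L) : ⁅f, (0 : SExpansion 𝒮 L)⁆ = 0 := by
  have h := SExpansion.lie_add f 0 0
  rw [add_zero] at h
  exact left_eq_add.mp h

/-- The defining commutation relations of the expansion. -/
theorem tmul_lie_tmul (α β : 𝒮) (x y : L) :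
    ⁅tmul α x, tmul β y⁆ = tmul (α * β) ⁅x, y⁆ := by
  refine (Finsupp.sum_single_index ?_).trans (Finsupp.sum_single_index ?_)
  · simp only [zero_lie, tmul_zero]
    exact Finset.sum_const_zero
  · rw [lie_zero, tmul_zero]

protected theorem skew (f g : SExpansion 𝒮 L) : ⁅f, g⁆ = -⁅g, f⁆ := by
  induction f using SExpansion.induction with
  | h0 => rw [SExpansion.zero_lie, SExpansion.lie_zero, neg_zero]
  | hadd a b ha hb => rw [SExpansion.add_lie, SExpansion.lie_add, ha, hb, neg_add]
  | hs α x =>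
    induction g using SExpansion.induction with
    | h0 => rw [SExpansion.zero_lie, SExpansion.lie_zero, neg_zero]
    | hadd a b ha hb => rw [SExpansion.add_lie, SExpansion.lie_add, ha, hb, neg_add]
    | hs β y => rw [tmul_lie_tmul, tmul_lie_tmul, mul_comm α β, ← lie_skew, tmul_neg]

protected theorem lie_self (f : SExpansion 𝒮 L) : ⁅f, f⁆ = 0 := by
  induction f using SExpansion.induction with
  | h0 => exact SExpansion.zero_lie 0
  | hadd a b ha hb =>
    rw [SExpansion.add_lie, SExpansion.lie_add, SExpansion.lie_add, ha, hb, SExpansion.skew a b]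
    simp
  | hs α x => rw [tmul_lie_tmul, lie_self, tmul_zero]

protected theorem leibniz_lie (f g h : SExpansion 𝒮 L) : ⁅f, ⁅g, h⁆⁆ = ⁅⁅f, g⁆, h⁆ + ⁅g, ⁅f, h⁆⁆ := by
  induction f using SExpansion.induction with
  | h0 => simp only [SExpansion.zero_lie, SExpansion.lie_zero, add_zero]
  | hadd a b ha hb =>
    simp only [SExpansion.add_lie, SExpansion.lie_add, ha, hb]
    abel
  | hs α x =>
    induction g using SExpansion.induction with
    | h0 => simp only [SExpansion.zero_lie, SExpansion.lie_zero, add_zero]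
    | hadd a b ha hb =>
      simp only [SExpansion.add_lie, SExpansion.lie_add, ha, hb]
      abel
    | hs β y =>
      induction h using SExpansion.induction with
      | h0 => simp only [SExpansion.lie_zero, add_zero]
      | hadd a b ha hb =>
        simp only [SExpansion.lie_add, ha, hb]
        abel
      | hs γ z =>
        simp only [tmul_lie_tmul]
        rw [leibniz_lie x y z, tmul_add, mul_assoc α β γ, mul_left_comm β α γ]

/-- The expansion of a Lie ring is a Lie ring. -/
instance : LieRing (SExpansion 𝒮 L) where
  add_lie := SExpansion.add_lie
  lie_add := SExpansion.lie_add
  lie_self := SExpansion.lie_self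
  leibniz_lie := SExpansion.leibniz_lie

/-- The expansion of a Lie algebra over `K` is a Lie algebra over `K`. -/
instance {K : Type*} [CommRing K] [LieAlgebra K L] : LieAlgebra K (SExpansion 𝒮 L) where
  lie_smul t f g := by
    induction f using SExpansion.induction with
    | h0 => simp only [SExpansion.zero_lie, smul_zero]
    | hadd a b ha hb => simp only [SExpansion.add_lie, ha, hb, smul_add]
    | hs α x =>
      induction g using SExpansion.induction with
      | h0 => simp only [smul_zero, SExpansion.lie_zero]
      | hadd a b ha hb => simp only [smul_add, SExpansion.lie_add, ha, hb]
      | hs β y => rw [← tmul_smul, tmul_lie_tmul, tmul_lie_tmul, lie_smul, tmul_smul]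

variable {K : Type*} [CommRing K] [LieAlgebra K L]

variable (𝒮) in
/-- The expansion `𝒮 ⊗ H` of a Lie subalgebra `H` of `L`, as a Lie subalgebra of `𝒮 ⊗ L`. -/
def ofSubalgebra (H : LieSubalgebra K L) : LieSubalgebra K (SExpansion 𝒮 L) where
  __ := ofSubmodule 𝒮 H.toSubmodule
  lie_mem' {f g} hf hg := by
    replace hf : f ∈ ofSubmodule 𝒮 H.toSubmodule := hf
    replace hg : g ∈ ofSubmodule 𝒮 H.toSubmodule := hg
    change ⁅f, g⁆ ∈ ofSubmodule 𝒮 H.toSubmodule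
    rw [ofSubmodule_eq_span] at hf hg ⊢
    induction hf using Submodule.span_induction with
    | zero => rw [zero_lie]; exact Submodule.zero_mem _
    | add a b _ _ ha hb => rw [add_lie]; exact Submodule.add_mem _ ha hb
    | smul t a _ ha => rw [smul_lie]; exact Submodule.smul_mem _ t ha
    | mem a ha =>
      obtain ⟨α, x, hx, rfl⟩ := ha
      induction hg using Submodule.span_induction with
      | zero => rw [lie_zero]; exact Submodule.zero_mem _
      | add a b _ _ ha hb => rw [lie_add]; exact Submodule.add_mem _ ha hb
      | smul t a _ ha => rw [lie_smul]; exact Submodule.smul_mem _ t ha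
      | mem b hb =>
        obtain ⟨β, y, hy, rfl⟩ := hb
        rw [tmul_lie_tmul]
        exact Submodule.subset_span ⟨α * β, _, H.lie_mem hx hy, rfl⟩

end

end SExpansion

/-- `A = I ⊎ B`: the Lie subalgebra `A` is the (internal) semidirect sum of `I`, which is an ideal
of `A`, and the Lie subalgebra `B`. -/
structure IsSemidirectSum {K L : Type*} [CommRing K] [LieRing L] [LieAlgebra K L]
    (A I B : LieSubalgebra K L) : Prop where
  sup_eq : I.toSubmodule ⊔ B.toSubmodule = A.toSubmodule
  inf_eq : I.toSubmodule ⊓ B.toSubmodule = ⊥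
  lie_mem : ∀ a ∈ A, ∀ x ∈ I, ⁅a, x⁆ ∈ I

/-- `L = N ⊎ S` is a Levi–Malcev decomposition: a semidirect sum in which the ideal `N` is the
radical of `L` and the subalgebra `S` is semisimple, i.e. has a nondegenerate Killing form. -/
structure IsLeviDecomposition {K L : Type*} [Field K] [LieRing L] [LieAlgebra K L]
    (N : LieIdeal K L) (S : LieSubalgebra K L) : Prop where
  semidirect : IsSemidirectSum ⊤ N.toLieSubalgebra S
  eq_radical : N = LieAlgebra.radical K L
  semisimple : LieAlgebra.IsKilling K S

/-! Since `N` is solvable, so is `𝒮 ⊗ N`, and the projection onto `𝒮 ⊗ S` along it is a homomorphism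
with solvable kernel. Radicals pull back along such surjections (`LieAlgebra.comap_radical`), so
every Levi–Malcev decomposition of `𝒮 ⊗ S` extends to the whole expansion
(`IsSemidirectSum.extend_levi`).

What remains is a Levi–Malcev decomposition of `𝒮 ⊗ S`, and it comes from the semigroup alone. For a
suitable exponent `m` all powers `s ^ m` are idempotent, and `s ↦ s ^ (m + 1)` retracts `𝒮` onto its
regular elements `R`, hence `𝒮 ⊗ S` onto `R ⊗ S`. The Killing form of an expansion is the trace form
of the semigroup times the Killing form of the Lie algebra (`killingForm_tmul_tmul`), where the
trace of `s` counts the fixed points of its translation.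

The retraction preserves these fixed points, so its kernel lies in the kernel of the Killing form,
which is solvable in characteristic `0` (`isSolvable_ker_map_of_retraction`). On `R` the trace form
is nondegenerate, because twisting one argument by the inverse turns it into a sum of squares
(`translationTrace_nondegenerate_int`). So `R ⊗ S` is semisimple. -/

/-! ### Finite commutative semigroups and their trace forms. -/

section Semigroup

/-- Without a unit, `s ^ (k + 1)` is encoded as `(s * ·)^[k] s`; this accounts for the extra `1` in
the exponent. -/
theorem CommSemigroup.iterate_mul_left_mul_iterate {M : Type*} [CommSemigroup M] (s : M)
    (i j : ℕ) : (s * ·)^[i] s * (s * ·)^[j] s = (s * ·)^[i + j + 1] s := by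
  induction i with
  | zero => rw [zero_add, Function.iterate_succ_apply']; rfl
  | succ i ih =>
    rw [Function.iterate_succ_apply', mul_assoc, ih, add_right_comm i 1 j,
      Function.iterate_succ_apply' _ (i + j + 1)]

/-- In a finite commutative semigroup there is a common exponent, at least `2`, for which the powers
of all elements are idempotent. -/
theorem CommSemigroup.exists_forall_isIdempotentElem_iterate (M : Type*) [CommSemigroup M]
    [Finite M] : ∃ n : ℕ, ∀ s : M, IsIdempotentElem ((s * ·)^[n + 1] s) := by
  have hper : ∀ s : M, ∃ i d : ℕ, ∀ k c, i ≤ k →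
      (s * ·)^[k + (d + 1) * c] s = (s * ·)^[k] s := by
    intro s
    -- Pigeonhole makes the powers of `s` eventually periodic: `i` bounds the preperiod and `d + 1`
    -- is a period.
    obtain ⟨i, j, hij, h⟩ := Finite.exists_ne_map_eq_of_infinite fun k : ℕ => (s * ·)^[k] s
    wlog hlt : i < j generalizing i j
    · exact this j i hij.symm h.symm (by omega)
    obtain ⟨d, rfl⟩ := Nat.exists_eq_add_of_lt hlt
    refine ⟨i, d, fun k c hk => ?_⟩
    have hstep : ∀ k, i ≤ k → (s * ·)^[k + (d + 1)] s = (s * ·)^[k] s := by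
      intro k hk
      obtain ⟨l, rfl⟩ := Nat.exists_eq_add_of_le' hk
      rw [add_assoc l, Function.iterate_add_apply _ l, Function.iterate_add_apply _ l i]
      exact congrArg _ h.symm
    induction c with
    | zero => rfl
    | succ c ih => rw [mul_add, mul_one, ← add_assoc, hstep _ (by omega), ih]
  choose i d h using hper
  have := Fintype.ofFinite M
  set P := ∏ s : M, (d s + 1) * (i s + 1)
  have hP : 0 < P := Finset.prod_pos fun s _ => by positivity
  -- The exponent is `2 * P`: a multiple of every period, beyond every preperiod, and at least `2`
  -- even if `P = 1`.
  refine ⟨2 * P - 2, fun s => ?_⟩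
  have hdvd : (d s + 1) * (i s + 1) ∣ P :=
    Finset.dvd_prod_of_mem (fun s => (d s + 1) * (i s + 1)) (Finset.mem_univ s)
  have hle : i s + 1 ≤ P :=
    (Nat.le_mul_of_pos_left _ (Nat.succ_pos _)).trans (Nat.le_of_dvd hP hdvd)
  obtain ⟨c, hc⟩ := (Dvd.intro _ rfl).trans hdvd
  rw [IsIdempotentElem, iterate_mul_left_mul_iterate]
  have := h s (2 * P - 2 + 1) (2 * c) (by omega)
  rwa [mul_left_comm, ← hc,
    show 2 * P - 2 + 1 + 2 * P = 2 * P - 2 + 1 + (2 * P - 2 + 1) + 1 by omega] at this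

/-- A finite commutative semigroup retracts onto its subsemigroup of regular elements, and the
retraction preserves the fixed points of the translations. -/
theorem CommSemigroup.exists_regular_retraction (M : Type*) [CommSemigroup M] [Finite M] :
    ∃ r : M →ₙ* M, (∀ s, r (r s) = r s) ∧ (∀ s, ∃ u, r (s * u * s) = r s) ∧
      ∀ s t, r s * t = t ↔ s * t = t := by
  obtain ⟨n, hn⟩ := exists_forall_isIdempotentElem_iterate M
  have hmul : ∀ k (s t : M), ((s * t) * ·)^[k] (s * t) = (s * ·)^[k] s * (t * ·)^[k] t := by
    intro k s t
    induction k with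
    | zero => rfl
    | succ k ih => simp only [Function.iterate_succ_apply', ih, mul_mul_mul_comm]
  have hid : ∀ k (e : M), IsIdempotentElem e → (e * ·)^[k] e = e := by
    intro k e he
    induction k with
    | zero => rfl
    | succ k ih => rw [Function.iterate_succ_apply', ih, he]
  have hfix : ∀ k (s t : M), s * t = t → (s * ·)^[k] s * t = t := by
    intro k s t h
    induction k with
    | zero => exact h
    | succ k ih => rw [Function.iterate_succ_apply', mul_assoc, ih, h]
  -- With `e = s ^ (n + 2)` idempotent, `r s = s ^ (n + 3) = s * e`.
  let r : M →ₙ* M := ⟨fun s => (s * ·)^[n + 2] s, hmul (n + 2)⟩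
  have hr : ∀ s, r s = s * (s * ·)^[n + 1] s := fun s => Function.iterate_succ_apply' _ _ _
  have hrr : ∀ s, r (r s) = r s := by
    intro s
    rw [hr s, map_mul, hr s, show r ((s * ·)^[n + 1] s) = _ from hid _ _ (hn s), mul_assoc, hn s]
  refine ⟨r, hrr, fun s => ⟨(s * ·)^[n] s, ?_⟩, fun s t => ⟨fun h => ?_, hfix _ s t⟩⟩
  · rw [mul_right_comm, mul_assoc, ← Function.iterate_succ_apply' (s * ·), ← hr, hrr]
  -- From `s * e * t = t` follows `e * t = t`, since `e` absorbs itself; then `e` can be dropped.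
  · rw [hr] at h
    have he : (s * ·)^[n + 1] s * t = t := by
      conv_lhs => rw [← h, mul_comm s, ← mul_assoc, ← mul_assoc, hn s]
      rwa [mul_comm s] at h
    rwa [mul_assoc, he] at h

/-- The trace of the translation by `s` on the semigroup algebra, i.e. the number of its fixed
points. -/
noncomputable def translationTrace {M : Type*} [Mul M] (s : M) : ℕ := Nat.card {t : M // s * t = t}

/-- The trace form of the semigroup algebra over `ℤ` of a finite commutative regular semigroup is
nondegenerate. -/
theorem translationTrace_nondegenerate_int {M : Type*} [CommSemigroup M] [Fintype M]
    (hreg : ∀ s : M, ∃ u, s * u * s = s) (f : M → ℤ)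
    (hf : ∀ u, ∑ s, (translationTrace (u * s) : ℤ) * f s = 0) : f = 0 := by
  classical
  obtain ⟨v, hv₁, hv₂⟩ : ∃ v : M → M, (∀ s, s * v s * s = s) ∧ ∀ s, v s * (s * v s) = v s := by
    choose u hu using hreg
    -- Replacing `u` by `u * s * u` makes the inverse relation symmetric, so that `e s = s * v s` is
    -- an idempotent fixing both `s` and `v s`.
    refine ⟨fun s => u s * s * u s, fun s => ?_, fun s => ?_⟩
    · calc s * (u s * s * u s) * s = s * u s * s * u s * s := by simp only [mul_assoc]
        _ = s := by rw [hu, hu]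
    · calc u s * s * u s * (s * (u s * s * u s)) = u s * (s * u s * s * u s * s) * u s := by
            simp only [mul_assoc]
        _ = u s * s * u s := by rw [hu, hu]
  let e : M → M := fun s => s * v s
  have hes : ∀ s, e s * s = s := hv₁
  have hee : ∀ s, e s * e s = e s := fun s => by
    change s * v s * (s * v s) = s * v s
    rw [mul_assoc, hv₂]
  -- Each `s` acts as a partial bijection with domain the fixed points of `e s`. The fixed points of
  -- `v u * s` are the points where `s` and `u` are both defined and agree.
  have key : ∀ s u t, v u * s * t = t ↔ (e s * t = t ∧ s * t = u * t) ∧ e u * t = t := by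
    intro s u t
    constructor
    · intro h
      have h₁ : e s * t = t := by
        calc e s * t = e s * (v u * s * t) := by rw [h]
          _ = v u * (e s * s) * t := by rw [mul_assoc (v u), mul_left_comm, ← mul_assoc (e s),
              ← mul_assoc]
          _ = t := by rw [hes, h]
      have h₂ : e u * t = t := by
        calc e u * t = e u * (v u * s * t) := by rw [h]
          _ = v u * (u * v u) * s * t := by rw [mul_assoc (v u), ← mul_assoc, mul_comm (e u),
              ← mul_assoc]
          _ = t := by rw [hv₂, h]
      refine ⟨⟨h₁, ?_⟩, h₂⟩
      calc s * t = s * (e u * t) := by rw [h₂]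
        _ = u * (v u * s * t) := by
          change s * (u * v u * t) = _
          ac_rfl
        _ = u * t := by rw [h]
    · rintro ⟨⟨-, h⟩, h₂⟩
      rw [mul_assoc, h, ← mul_assoc, mul_comm (v u)]
      exact h₂
  have hF : ∀ t w, ∑ s with e s * t = t ∧ s * t = w, f s = 0 := by
    -- By `key`, the trace form at `∑ f u • v u` and `∑ f s • s` is a sum of squares over pairs `(t,
    -- w)`. It vanishes by `hf`, and positivity in `ℤ` kills each square.
    have hsum : ∑ t, ∑ w, (∑ s with e s * t = t ∧ s * t = w, f s) ^ 2 = 0 := by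
      calc ∑ t, ∑ w, (∑ s with e s * t = t ∧ s * t = w, f s) ^ 2
          = ∑ t, ∑ w, ∑ u, ∑ s, (if (e u * t = t ∧ u * t = w) ∧ (e s * t = t ∧ s * t = w)
              then f u * f s else 0) := by
            refine Finset.sum_congr rfl fun t _ => Finset.sum_congr rfl fun w _ => ?_
            rw [sq, Finset.sum_filter, Finset.sum_mul_sum]
            refine Finset.sum_congr rfl fun u _ => Finset.sum_congr rfl fun s _ => ?_
            rw [ite_zero_mul_ite_zero]
        _ = ∑ t, ∑ u, ∑ s, (if v u * s * t = t then f u * f s else 0) := by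
            refine Finset.sum_congr rfl fun t _ => ?_
            rw [Finset.sum_comm]
            refine Finset.sum_congr rfl fun u _ => ?_
            rw [Finset.sum_comm]
            refine Finset.sum_congr rfl fun s _ => ?_
            -- Only `w = u * t` contributes.
            rw [Finset.sum_eq_single (u * t)]
            · refine if_congr ?_ rfl rfl
              rw [key]
              tauto
            · intro w _ hw
              exact if_neg fun h => hw h.1.2.symm
            · simp
        _ = ∑ u, ∑ s, (translationTrace (v u * s) : ℤ) * (f u * f s) := by
            rw [Finset.sum_comm]
            refine Finset.sum_congr rfl fun u _ => ?_
            rw [Finset.sum_comm]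
            refine Finset.sum_congr rfl fun s _ => ?_
            rw [← Finset.sum_filter, Finset.sum_const, nsmul_eq_mul, translationTrace,
              Nat.card_eq_fintype_card, Fintype.card_subtype]
        _ = ∑ u, f u * ∑ s, (translationTrace (v u * s) : ℤ) * f s := by
            refine Finset.sum_congr rfl fun u _ => ?_
            rw [Finset.mul_sum]
            exact Finset.sum_congr rfl fun s _ => by ring
        _ = 0 := by simp [hf]
    intro t w
    rw [Finset.sum_eq_zero_iff_of_nonneg fun _ _ => Finset.sum_nonneg fun _ _ => sq_nonneg _]
      at hsum
    have h := hsum t (Finset.mem_univ t)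
    rw [Finset.sum_eq_zero_iff_of_nonneg fun _ _ => sq_nonneg _] at h
    exact pow_eq_zero_iff two_ne_zero |>.mp (h w (Finset.mem_univ w))
  by_contra hne
  obtain ⟨a, ha⟩ := Function.ne_iff.mp hne
  -- Choose `s₀` in the support of `f` with `e s₀` maximal. In the sum at `t = e s₀`, `w = s₀` any
  -- other `s` in the support has `e s` above `e s₀`; maximality forces `e s = e s₀`, hence `s =
  -- s₀`.
  obtain ⟨s₀, hs₀, hmax⟩ := Finset.exists_max_image (Finset.univ.filter fun s => f s ≠ 0)
    (fun s => (Finset.univ.filter fun t => e s * t = t).card) ⟨a, by simpa using ha⟩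
  rw [Finset.mem_filter] at hs₀
  apply hs₀.2
  rw [← hF (e s₀) s₀, eq_comm]
  refine Finset.sum_eq_single s₀ (fun s hs hne' => ?_) fun h => ?_
  · simp only [Finset.mem_filter, Finset.mem_univ, true_and] at hs
    by_contra hfs
    apply hne'
    have hsub : (Finset.univ.filter fun t => e s₀ * t = t) ⊆
        Finset.univ.filter fun t => e s * t = t := by
      intro t ht
      simp only [Finset.mem_filter, Finset.mem_univ, true_and] at ht ⊢
      rw [← ht, ← mul_assoc, hs.1]
    have heq := Finset.eq_of_subset_of_card_le hsub (hmax s (by simpa using hfs))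
    have hmem : e s ∈ Finset.univ.filter fun t => e s₀ * t = t := by
      rw [heq]
      simpa using hee s
    have h : e s₀ * e s = e s := by simpa using hmem
    have : e s = e s₀ := by rw [← h, mul_comm, hs.1]
    rw [← hs.2, ← this, mul_comm, hes]
  · exact absurd (by simp [hee, mul_comm s₀, hes]) h

/-- Positivity is unavailable in `K`, but the Gram matrix is integral, and its nonzero determinant
stays nonzero in characteristic `0`. -/
theorem translationTrace_nondegenerate {K M : Type*} [Field K] [CharZero K] [CommSemigroup M]
    [Fintype M] (hreg : ∀ s : M, ∃ u, s * u * s = s) (f : M → K)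
    (hf : ∀ u, ∑ s, (translationTrace (u * s) : K) * f s = 0) : f = 0 := by
  classical
  let A : Matrix M M ℤ := Matrix.of fun u s => (translationTrace (u * s) : ℤ)
  have hA : A.det ≠ 0 := by
    intro h
    obtain ⟨g, hg, hg'⟩ := Matrix.exists_mulVec_eq_zero_iff.mpr h
    exact hg (translationTrace_nondegenerate_int hreg g fun u => congrFun hg' u)
  have hAK : (A.map (Int.castRingHom K)).det ≠ 0 := by
    rw [← RingHom.mapMatrix_apply, ← RingHom.map_det]
    simpa using hA
  refine Matrix.eq_zero_of_mulVec_eq_zero hAK (funext fun u => ?_)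
  simpa [A, Matrix.mulVec, dotProduct] using hf u

end Semigroup

/-! ### Radicals and Levi–Malcev decompositions under homomorphisms. -/

section Radical

open LieAlgebra

variable {K L L' : Type*} [Field K] [LieRing L] [LieAlgebra K L] [LieRing L'] [LieAlgebra K L']

theorem LieIdeal.derivedSeriesOfIdeal_comap_le (f : L →ₗ⁅K⁆ L') (J : LieIdeal K L') (k : ℕ) :
    derivedSeriesOfIdeal K L k (J.comap f) ≤ (derivedSeriesOfIdeal K L' k J).comap f := by
  induction k with
  | zero => exact le_rfl
  | succ k ih =>
    rw [derivedSeriesOfIdeal_succ, derivedSeriesOfIdeal_succ]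
    exact (LieSubmodule.mono_lie ih ih).trans (LieIdeal.comap_bracket_le f)

theorem LieIdeal.derivedSeriesOfIdeal_map_le {f : L →ₗ⁅K⁆ L'} (hf : Function.Surjective f)
    (I : LieIdeal K L) (k : ℕ) :
    derivedSeriesOfIdeal K L' k (I.map f) ≤ (derivedSeriesOfIdeal K L k I).map f := by
  induction k with
  | zero => exact le_rfl
  | succ k ih =>
    rw [derivedSeriesOfIdeal_succ, derivedSeriesOfIdeal_succ, LieIdeal.map_bracket_eq f hf]
    exact LieSubmodule.mono_lie ih ih

theorem LieIdeal.isSolvable_iff_derivedSeriesOfIdeal (I : LieIdeal K L) :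
    IsSolvable I ↔ ∃ k, derivedSeriesOfIdeal K L k I = ⊥ := by
  rw [isSolvable_iff K]
  exact exists_congr fun k => derivedSeries_eq_bot_iff I k

theorem LieIdeal.isSolvable_comap (f : L →ₗ⁅K⁆ L') (hf : IsSolvable f.ker) (J : LieIdeal K L')
    (hJ : IsSolvable J) : IsSolvable (J.comap f) := by
  rw [isSolvable_iff_derivedSeriesOfIdeal] at hf hJ ⊢
  obtain ⟨k, hk⟩ := hf
  obtain ⟨l, hl⟩ := hJ
  refine ⟨k + l, ?_⟩
  rw [derivedSeriesOfIdeal_add, eq_bot_iff, ← hk]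
  refine derivedSeriesOfIdeal_mono ?_ k
  refine (derivedSeriesOfIdeal_comap_le f J l).trans ?_
  rw [hl]
  exact le_rfl

theorem LieIdeal.isSolvable_map {f : L →ₗ⁅K⁆ L'} (hf : Function.Surjective f) (I : LieIdeal K L)
    (hI : IsSolvable I) : IsSolvable (I.map f) := by
  rw [isSolvable_iff_derivedSeriesOfIdeal] at hI ⊢
  obtain ⟨k, hk⟩ := hI
  refine ⟨k, ?_⟩
  rw [eq_bot_iff]
  refine (derivedSeriesOfIdeal_map_le hf I k).trans ?_
  rw [hk, LieIdeal.map_le_iff_le_comap]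
  exact bot_le

/-- An extension of a solvable ideal by a solvable kernel is solvable, and the image of a solvable
ideal under a surjection is a solvable ideal. -/
theorem LieAlgebra.comap_radical [FiniteDimensional K L] [FiniteDimensional K L']
    {f : L →ₗ⁅K⁆ L'} (hf : Function.Surjective f) (hker : IsSolvable f.ker) :
    (radical K L').comap f = radical K L := by
  apply le_antisymm
  · rw [← LieIdeal.solvable_iff_le_radical]
    exact LieIdeal.isSolvable_comap f hker _ inferInstance
  · rw [← LieIdeal.map_le_iff_le_comap, ← LieIdeal.solvable_iff_le_radical]
    exact LieIdeal.isSolvable_map hf _ inferInstance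

/-- A retraction with solvable kernel onto an algebra with nondegenerate Killing form gives rise to
a Levi–Malcev decomposition. -/
theorem IsLeviDecomposition.of_retraction [FiniteDimensional K L] [FiniteDimensional K L']
    [IsKilling K L'] (p : L →ₗ⁅K⁆ L') (i : L' →ₗ⁅K⁆ L) (hpi : ∀ x, p (i x) = x)
    (hker : IsSolvable p.ker) : IsLeviDecomposition p.ker i.range where
  semidirect :=
    { sup_eq := by
        rw [LieSubalgebra.top_toSubmodule, eq_top_iff]
        intro x _
        rw [← sub_add_cancel x (i (p x))]
        refine Submodule.add_mem_sup ?_ ⟨p x, rfl⟩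
        change x - i (p x) ∈ p.ker
        rw [LieHom.mem_ker, map_sub, hpi, sub_self]
      inf_eq := by
        rw [eq_bot_iff]
        rintro _ ⟨hx, ⟨y, rfl⟩⟩
        have hy : p (i y) = 0 := LieHom.mem_ker.mp hx
        rw [hpi] at hy
        rw [hy]
        exact Submodule.mem_bot K |>.mpr (map_zero i)
      lie_mem := fun a _ x hx => lie_mem_right K L p.ker a x hx }
  eq_radical := by
    -- The target has trivial radical, so the radical of `L` is the preimage of zero.
    rw [← comap_radical (f := p) (fun x => ⟨i x, hpi x⟩) hker, HasTrivialRadical.radical_eq_bot]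
    rfl
  semisimple := by
    have := (LieEquiv.ofInjective i (Function.LeftInverse.injective hpi))
    exact isKilling_of_equiv this

/-- The projection of a semidirect sum onto the complement of the ideal. -/
theorem IsSemidirectSum.exists_projection {I : LieIdeal K L} {B : LieSubalgebra K L}
    (h : IsSemidirectSum ⊤ I.toLieSubalgebra B) :
    ∃ p : L →ₗ⁅K⁆ B, (∀ b : B, p b = b) ∧ p.ker = I := by
  have hc : IsCompl B.toSubmodule I.toSubmodule :=
    (isCompl_iff.mpr ⟨disjoint_iff.mpr h.inf_eq, codisjoint_iff.mpr h.sup_eq⟩).symm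
  let q : L →ₗ[K] B := B.toSubmodule.projectionOnto I.toSubmodule hc
  have hq : ∀ b : B, q b = b := fun b => Submodule.projectionOnto_apply_left hc b
  have hq0 : ∀ x, q x = 0 ↔ x ∈ I := fun x => Submodule.projectionOnto_apply_eq_zero_iff hc
  have hsub : ∀ x, x - q x ∈ I := fun x => by rw [← hq0, map_sub, hq, sub_self]
  let p : L →ₗ⁅K⁆ B :=
    { q with
      map_lie' := by
        intro x y
        change q ⁅x, y⁆ = ⁅q x, q y⁆
        rw [← sub_eq_zero, ← hq ⁅q x, q y⁆, ← map_sub, hq0, LieSubalgebra.coe_bracket]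
        -- Both brackets on the right have an entry in `I`, which makes `q` multiplicative.
        have : ⁅x, y⁆ - ⁅(q x : L), (q y : L)⁆ = ⁅x - q x, y⁆ + ⁅(q x : L), y - q y⁆ := by
          rw [sub_lie, lie_sub]
          abel
        rw [this]
        exact I.add_mem (lie_mem_left K L I _ _ (hsub x)) (lie_mem_right K L I _ _ (hsub y)) }
  refine ⟨p, hq, ?_⟩
  ext x
  exact LieHom.mem_ker.trans (hq0 x)

/-- A Levi–Malcev decomposition of the complement of a solvable ideal extends to the whole
algebra. -/
theorem IsSemidirectSum.extend_levi [FiniteDimensional K L] {I : LieIdeal K L}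
    {B : LieSubalgebra K L} (h : IsSemidirectSum ⊤ I.toLieSubalgebra B) (hI : IsSolvable I)
    {N : LieIdeal K B} {S : LieSubalgebra K B} (hB : IsLeviDecomposition N S) :
    IsSemidirectSum (radical K L).toLieSubalgebra I.toLieSubalgebra
        (N.toLieSubalgebra.map B.incl) ∧
      IsLeviDecomposition (radical K L) (S.map B.incl) := by
  -- Everything is read off from `p`: the radical of `L` is the preimage of `N`.
  obtain ⟨p, hp, hker⟩ := h.exists_projection
  have hrad : radical K L = N.comap p := by
    rw [hB.eq_radical, comap_radical (f := p) (fun b => ⟨b, hp b⟩) (by rwa [hker])]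
  have hsub : ∀ x, x - p x ∈ I := fun x => by
    rw [← hker, LieHom.mem_ker, map_sub, hp, sub_self]
  have hpI : ∀ x, x ∈ I → p x = 0 := fun x hx => by rwa [← hker, LieHom.mem_ker] at hx
  have hmem : ∀ x, x ∈ radical K L ↔ p x ∈ N := fun x => by rw [hrad, LieIdeal.mem_comap]
  refine ⟨⟨?_, ?_, fun a _ x hx => lie_mem_right K L I a x hx⟩, ⟨⟨?_, ?_, fun a _ x hx =>
    lie_mem_right K L _ a x hx⟩, rfl, ?_⟩⟩
  · apply le_antisymm
    · refine sup_le (fun x hx => ?_) ?_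
      · exact (hmem x).mpr (by rw [hpI x hx]; exact N.zero_mem)
      · rintro _ ⟨y, hy, rfl⟩
        refine (hmem _).mpr ?_
        change p (y : L) ∈ N
        rw [hp]
        exact hy
    · intro x hx
      rw [← sub_add_cancel x (p x)]
      exact Submodule.add_mem_sup (hsub x) ⟨p x, (hmem x).mp hx, rfl⟩
  · rw [eq_bot_iff, ← h.inf_eq]
    refine inf_le_inf_left _ ?_
    rintro _ ⟨y, -, rfl⟩
    exact y.2
  · rw [LieSubalgebra.top_toSubmodule, eq_top_iff]
    intro x _
    have hx : p x ∈ N.toLieSubalgebra.toSubmodule ⊔ S.toSubmodule := by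
      rw [hB.semidirect.sup_eq]
      trivial
    obtain ⟨n, hn, s, hs, hns⟩ := Submodule.mem_sup.mp hx
    have : x = (x - s) + s := (sub_add_cancel _ _).symm
    rw [this]
    refine Submodule.add_mem_sup ((hmem _).mpr ?_) ⟨s, hs, rfl⟩
    rw [map_sub, hp, ← hns, add_sub_cancel_right]
    exact hn
  · rw [eq_bot_iff]
    rintro _ ⟨hx, ⟨y, hy, rfl⟩⟩
    have hy' : p (y : L) ∈ N := (hmem _).mp hx
    rw [hp] at hy'
    have : y ∈ N.toLieSubalgebra.toSubmodule ⊓ S.toSubmodule := ⟨hy', hy⟩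
    rw [hB.semidirect.inf_eq, Submodule.mem_bot] at this
    rw [this]
    exact Submodule.zero_mem _
  · have := hB.semisimple
    let g : S →ₗ⁅K⁆ L := B.incl.comp S.incl
    have hg : Function.Injective g := fun x y hxy => Subtype.ext (Subtype.ext hxy)
    refine isKilling_of_equiv ((LieEquiv.ofInjective g hg).trans (LieEquiv.ofEq _ _ ?_))
    ext x
    constructor
    · rintro ⟨y, rfl⟩
      exact ⟨y, y.2, rfl⟩
    · rintro ⟨y, hy, rfl⟩
      exact ⟨⟨y, hy⟩, rfl⟩

end Radical

/-! ### Linear algebra, functoriality and ideals of expansions. -/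

namespace SExpansion

noncomputable section

section Linear

variable {K 𝒮 L M : Type*} [CommRing K] [LieRing L] [LieAlgebra K L] [AddCommGroup M] [Module K M]

/-- The linear map out of the expansion given on each copy `α ⊗ L` of `L`. -/
def lift (φ : 𝒮 → L →ₗ[K] M) : SExpansion 𝒮 L →ₗ[K] M := Finsupp.lsum K φ

theorem lift_tmul (φ : 𝒮 → L →ₗ[K] M) (α : 𝒮) (x : L) : lift φ (tmul α x) = φ α x :=
  Finsupp.sum_single_index (map_zero (φ α))

theorem lift_apply [Fintype 𝒮] (φ : 𝒮 → L →ₗ[K] M) (f : SExpansion 𝒮 L) :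
    lift φ f = ∑ α, φ α (f.coeff α) :=
  Finsupp.sum_fintype _ _ fun α => map_zero (φ α)

theorem linearMap_ext {φ ψ : SExpansion 𝒮 L →ₗ[K] M}
    (h : ∀ α x, φ (tmul α x) = ψ (tmul α x)) : φ = ψ := by
  ext f
  induction f using SExpansion.induction with
  | h0 => rw [map_zero, map_zero]
  | hadd f g hf hg => rw [map_add, map_add, hf, hg]
  | hs α x => exact h α x

theorem coeff_injective : Function.Injective (coeff : SExpansion 𝒮 L → 𝒮 →₀ L) := fun _ _ h => h

theorem coeff_tmul [DecidableEq 𝒮] (α β : 𝒮) (x : L) :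
    (tmul α x).coeff β = if α = β then x else 0 := Finsupp.single_apply

variable (K) in
/-- The inclusion `x ↦ α ⊗ x` as a linear map. -/
def tmulₗ (α : 𝒮) : L →ₗ[K] SExpansion 𝒮 L where
  toFun := tmul α
  map_add' := tmul_add α
  map_smul' t x := tmul_smul t α x

/-- The basis of the expansion given by a basis of the Lie algebra. -/
def basis {ι : Type*} (b : Module.Basis ι K L) :
    Module.Basis (Σ _ : 𝒮, ι) K (SExpansion 𝒮 L) :=
  Finsupp.basis fun _ : 𝒮 => b

theorem basis_apply {ι : Type*} (b : Module.Basis ι K L) (i : Σ _ : 𝒮, ι) :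
    basis b i = tmul i.1 (b i.2) :=
  congrFun (Finsupp.coe_basis fun _ : 𝒮 => b) i

theorem basis_repr {ι : Type*} (b : Module.Basis ι K L) (f : SExpansion 𝒮 L) (i : Σ _ : 𝒮, ι) :
    (basis b).repr f i = b.repr (f.coeff i.1) i.2 := rfl

instance [Finite 𝒮] [Module.Finite K L] : Module.Finite K (SExpansion 𝒮 L) :=
  inferInstanceAs (Module.Finite K (𝒮 →₀ L))

end Linear

section Map

variable {K 𝒮 𝒯 L L' : Type*} [CommRing K] [CommSemigroup 𝒮] [CommSemigroup 𝒯]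
  [LieRing L] [LieAlgebra K L] [LieRing L'] [LieAlgebra K L']

/-- The homomorphism of expansions given by homomorphisms of both factors. -/
def map (r : 𝒮 →ₙ* 𝒯) (f : L →ₗ⁅K⁆ L') : SExpansion 𝒮 L →ₗ⁅K⁆ SExpansion 𝒯 L' where
  __ := lift fun α => tmulₗ K (r α) ∘ₗ (f : L →ₗ[K] L')
  map_lie' {g h} := by
    change lift _ _ = ⁅lift _ _, lift _ _⁆
    induction g using SExpansion.induction with
    | h0 => simp only [zero_lie, map_zero]
    | hadd a b ha hb => rw [add_lie, map_add, map_add, add_lie, ha, hb]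
    | hs α x =>
      induction h using SExpansion.induction with
      | h0 => simp only [lie_zero, map_zero]
      | hadd a b ha hb => rw [lie_add, map_add, map_add, lie_add, ha, hb]
      | hs β y =>
        rw [tmul_lie_tmul, lift_tmul, lift_tmul, lift_tmul, map_mul]
        exact (congrArg _ (f.map_lie x y)).trans (tmul_lie_tmul _ _ _ _).symm

theorem map_tmul (r : 𝒮 →ₙ* 𝒯) (f : L →ₗ⁅K⁆ L') (α : 𝒮) (x : L) :
    map r f (tmul α x) = tmul (r α) (f x) := lift_tmul _ α x

theorem coeff_map_id (f : L →ₗ⁅K⁆ L') (g : SExpansion 𝒮 L) (α : 𝒮) :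
    (map (MulHom.id 𝒮) f g).coeff α = f (g.coeff α) := by
  classical
  induction g using SExpansion.induction with
  | h0 => rw [map_zero]; exact (map_zero f).symm
  | hadd a b ha hb =>
    rw [map_add]
    change (map (MulHom.id 𝒮) f a).coeff α + (map (MulHom.id 𝒮) f b).coeff α =
      f (a.coeff α + b.coeff α)
    rw [ha, hb, map_add]
  | hs β x =>
    rw [map_tmul, coeff_tmul, coeff_tmul, apply_ite f, map_zero]
    rfl

theorem map_id_injective {f : L →ₗ⁅K⁆ L'} (hf : Function.Injective f) :
    Function.Injective (map (MulHom.id 𝒮) f) := by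
  intro g h hgh
  refine coeff_injective (Finsupp.ext fun α => hf ?_)
  rw [← coeff_map_id, ← coeff_map_id, hgh]

/-- The expansion of a subalgebra, as an algebra, is the corresponding subalgebra of the
expansion. -/
def equivOfSubalgebra (H : LieSubalgebra K L) : SExpansion 𝒮 H ≃ₗ⁅K⁆ ofSubalgebra 𝒮 H :=
  (LieEquiv.ofInjective (map (MulHom.id 𝒮) H.incl)
    (map_id_injective Subtype.val_injective)).trans <| LieEquiv.ofEq _ _ <| by
      refine Set.Subset.antisymm ?_ ?_
      · rintro _ ⟨g, rfl⟩ α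
        change (map (MulHom.id 𝒮) H.incl g).coeff α ∈ H
        rw [coeff_map_id]
        exact (g.coeff α).2
      · intro g hg
        replace hg : g ∈ ofSubmodule 𝒮 H.toSubmodule := hg
        change g ∈ (map (MulHom.id 𝒮) H.incl).range.toSubmodule
        rw [ofSubmodule_eq_span] at hg
        refine Submodule.span_le.mpr ?_ hg
        rintro _ ⟨α, x, hx, rfl⟩
        exact ⟨tmul α ⟨x, hx⟩, map_tmul _ _ _ _⟩

end Map

section Ideal

variable {K 𝒮 L : Type*} [CommSemigroup 𝒮] [Field K] [LieRing L] [LieAlgebra K L]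

theorem lie_mem_ofSubmodule {U V W : Submodule K L} (h : ∀ x ∈ U, ∀ y ∈ V, ⁅x, y⁆ ∈ W)
    {f g : SExpansion 𝒮 L} (hf : f ∈ ofSubmodule 𝒮 U) (hg : g ∈ ofSubmodule 𝒮 V) :
    ⁅f, g⁆ ∈ ofSubmodule 𝒮 W := by
  rw [ofSubmodule_eq_span] at hf hg ⊢
  induction hf using Submodule.span_induction with
  | zero => rw [zero_lie]; exact Submodule.zero_mem _
  | add a b _ _ ha hb => rw [add_lie]; exact Submodule.add_mem _ ha hb
  | smul t a _ ha => rw [smul_lie]; exact Submodule.smul_mem _ t ha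
  | mem a ha =>
    obtain ⟨α, x, hx, rfl⟩ := ha
    induction hg using Submodule.span_induction with
    | zero => rw [lie_zero]; exact Submodule.zero_mem _
    | add a b _ _ ha hb => rw [lie_add]; exact Submodule.add_mem _ ha hb
    | smul t a _ ha => rw [lie_smul]; exact Submodule.smul_mem _ t ha
    | mem b hb =>
      obtain ⟨β, y, hy, rfl⟩ := hb
      rw [tmul_lie_tmul]
      exact Submodule.subset_span ⟨α * β, _, h x hx y hy, rfl⟩

variable (𝒮) in
/-- The expansion of an ideal of `L`, as an ideal of the expansion of `L`. -/
def ofIdeal (I : LieIdeal K L) : LieIdeal K (SExpansion 𝒮 L) where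
  __ := ofSubmodule 𝒮 I.toSubmodule
  lie_mem hg := lie_mem_ofSubmodule (U := ⊤) (V := I.toSubmodule)
    (fun x _ y hy => lie_mem_right K L I x y hy) (fun _ => Submodule.mem_top) hg

theorem derivedSeriesOfIdeal_ofIdeal_le (I : LieIdeal K L) (k : ℕ) :
    LieAlgebra.derivedSeriesOfIdeal K (SExpansion 𝒮 L) k (ofIdeal 𝒮 I) ≤
      ofIdeal 𝒮 (LieAlgebra.derivedSeriesOfIdeal K L k I) := by
  induction k with
  | zero => exact le_rfl
  | succ k ih =>
    rw [LieAlgebra.derivedSeriesOfIdeal_succ, LieAlgebra.derivedSeriesOfIdeal_succ]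
    refine (LieSubmodule.mono_lie ih ih).trans ?_
    rw [LieSubmodule.lie_le_iff]
    intro f hf g hg
    exact lie_mem_ofSubmodule (fun x hx y hy => LieSubmodule.lie_mem_lie hx hy) hf hg

theorem isSolvable_ofIdeal {I : LieIdeal K L} (hI : LieAlgebra.IsSolvable I) :
    LieAlgebra.IsSolvable (ofIdeal 𝒮 I) := by
  rw [LieIdeal.isSolvable_iff_derivedSeriesOfIdeal] at hI ⊢
  obtain ⟨k, hk⟩ := hI
  refine ⟨k, eq_bot_iff.mpr ((derivedSeriesOfIdeal_ofIdeal_le I k).trans ?_)⟩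
  rw [hk]
  intro f hf
  exact (LieSubmodule.mem_bot f).mpr (coeff_injective (Finsupp.ext fun α => hf α))

theorem isSemidirectSum_ofSubalgebra {I : LieIdeal K L} {B : LieSubalgebra K L}
    (h : IsSemidirectSum ⊤ I.toLieSubalgebra B) :
    IsSemidirectSum ⊤ (ofSubalgebra 𝒮 I.toLieSubalgebra) (ofSubalgebra 𝒮 B) where
  sup_eq := by
    rw [LieSubalgebra.top_toSubmodule, eq_top_iff]
    intro f _
    induction f using SExpansion.induction with
    | h0 => exact Submodule.zero_mem _
    | hadd f g hf hg => exact Submodule.add_mem _ (hf trivial) (hg trivial)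
    | hs α x =>
      have hx : x ∈ I.toLieSubalgebra.toSubmodule ⊔ B.toSubmodule := by
        rw [h.sup_eq]
        trivial
      obtain ⟨y, hy, z, hz, rfl⟩ := Submodule.mem_sup.mp hx
      rw [tmul_add]
      refine Submodule.add_mem_sup ?_ ?_
      · change tmul α y ∈ ofSubmodule 𝒮 I.toLieSubalgebra.toSubmodule
        rw [ofSubmodule_eq_span]
        exact Submodule.subset_span ⟨α, y, hy, rfl⟩
      · change tmul α z ∈ ofSubmodule 𝒮 B.toSubmodule
        rw [ofSubmodule_eq_span]
        exact Submodule.subset_span ⟨α, z, hz, rfl⟩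
  inf_eq := by
    rw [eq_bot_iff]
    rintro f ⟨hf, hf'⟩
    refine (Submodule.mem_bot K).mpr (coeff_injective (Finsupp.ext fun α => ?_))
    have : f.coeff α ∈ I.toLieSubalgebra.toSubmodule ⊓ B.toSubmodule := ⟨hf α, hf' α⟩
    rw [h.inf_eq] at this
    exact this
  lie_mem f _ g hg := lie_mem_right K _ (ofIdeal 𝒮 I) f g hg

end Ideal

/-! ### The Killing form of an expansion. -/

section Killing

variable {K 𝒮 L : Type*} [CommSemigroup 𝒮] [Finite 𝒮] [Field K] [LieRing L] [LieAlgebra K L]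
  [FiniteDimensional K L]

/-- The composite of the two adjoint maps is translation by `α * β` tensored with `ad x ∘ ad y`, so
the diagonal blocks that contribute are those at fixed points `γ`. -/
theorem killingForm_tmul_tmul (α β : 𝒮) (x y : L) :
    killingForm K (SExpansion 𝒮 L) (tmul α x) (tmul β y) =
      translationTrace (α * β) * killingForm K L x y := by
  classical
  have := Fintype.ofFinite 𝒮
  let b := Module.finBasis K L
  rw [LieModule.traceForm_apply_apply, LieModule.traceForm_apply_apply,
    LinearMap.trace_eq_matrix_trace K (basis b), LinearMap.trace_eq_matrix_trace K b,
    Matrix.trace, Matrix.trace, Fintype.sum_sigma, translationTrace, Nat.card_eq_fintype_card,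
    Fintype.card_subtype, ← nsmul_eq_mul, ← Finset.sum_const, Finset.sum_filter]
  refine Finset.sum_congr rfl fun γ _ => ?_
  simp only [Matrix.diag_apply, LinearMap.toMatrix_apply, basis_apply, basis_repr,
    LinearMap.comp_apply, LieModule.toEnd_apply_apply, tmul_lie_tmul, coeff_tmul, ← mul_assoc]
  split_ifs
  · rfl
  · simp

/-- The expansion by a regular semigroup preserves nondegeneracy of the Killing form. -/
theorem isKilling_of_regular [CharZero K] [LieAlgebra.IsKilling K L]
    (hreg : ∀ s : 𝒮, ∃ u, s * u * s = s) : LieAlgebra.IsKilling K (SExpansion 𝒮 L) where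
  killingCompl_top_eq_bot := by
    have := Fintype.ofFinite 𝒮
    rw [eq_bot_iff]
    intro f hf
    rw [LieSubmodule.mem_bot]
    refine coeff_injective (Finsupp.ext fun α => ?_)
    -- Testing coordinates against functionals reduces the claim to the scalar trace form.
    refine (Module.forall_dual_apply_eq_zero_iff K (f.coeff α)).mp fun φ => ?_
    suffices h : (fun s => φ (f.coeff s)) = 0 from congrFun h α
    refine translationTrace_nondegenerate hreg _ fun β => ?_
    -- Pairing `f` with all `β ⊗ y` puts this vector in the kernel of the Killing form of `L`.
    have h0 : ∑ s, (translationTrace (β * s) : K) • f.coeff s = 0 := by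
      have hker : ∑ s, (translationTrace (β * s) : K) • f.coeff s ∈
          LinearMap.ker (killingForm K L) := by
        rw [LinearMap.mem_ker]
        ext y
        have h := (LieIdeal.mem_killingCompl K _ ⊤).mp hf (tmul β y) (LieSubmodule.mem_top _)
        have heq : killingForm K (SExpansion 𝒮 L) (tmul β y) =
            lift fun s => (translationTrace (β * s) : K) • killingForm K L y := by
          refine linearMap_ext fun s x => ?_
          rw [lift_tmul, killingForm_tmul_tmul, LinearMap.smul_apply, smul_eq_mul]
        change killingForm K (SExpansion 𝒮 L) (tmul β y) f = 0 at h
        rw [heq, lift_apply] at h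
        rw [LinearMap.zero_apply, LieModule.traceForm_comm, map_sum, ← h]
        exact Finset.sum_congr rfl fun s _ => map_smul _ _ _
      rwa [LieAlgebra.IsKilling.ker_killingForm_eq_bot] at hker
    rw [← map_zero φ, ← h0, map_sum]
    exact Finset.sum_congr rfl fun s _ => (map_smul φ _ _).symm

/-- Since `s` and `i (r s)` have equal traces against every `u`, the Killing form factors through
`map r` in its second argument. So the kernel of `map r` is orthogonal to everything, and in
characteristic `0` such an ideal is solvable. -/
theorem isSolvable_ker_map_of_retraction [CharZero K] {𝒯 : Type*} [CommSemigroup 𝒯]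
    (r : 𝒮 →ₙ* 𝒯) (i : 𝒯 →ₙ* 𝒮)
    (hr : ∀ s t, i (r s) * t = t ↔ s * t = t) (hri : ∀ s, r (i s) = s) :
    LieAlgebra.IsSolvable (map r (1 : L →ₗ⁅K⁆ L)).ker := by
  have htr : ∀ s u, translationTrace (u * i (r s)) = translationTrace (u * s) := by
    intro s u
    refine Nat.card_congr (Equiv.subtypeEquivRight fun t => ?_)
    rw [← hr, ← hr (u * s), map_mul, map_mul, map_mul, map_mul, hri]
  rw [LieAlgebra.LieIdeal.solvable_iff_le_radical]
  refine le_trans ?_ (LieAlgebra.killingCompl_top_le_radical K _)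
  intro f hf
  rw [LieIdeal.mem_killingCompl]
  rw [LieHom.mem_ker] at hf
  suffices ∀ g, killingForm K (SExpansion 𝒮 L) g f = 0 from fun g _ => this g
  intro g
  induction g using SExpansion.induction with
  | h0 => rw [map_zero, LinearMap.zero_apply]
  | hadd g h hg hh => rw [map_add, LinearMap.add_apply, hg, hh, add_zero]
  | hs β y =>
    have heq : killingForm K (SExpansion 𝒮 L) (tmul β y) =
        (lift fun s : 𝒯 => (translationTrace (β * i s) : K) • killingForm K L y) ∘ₗ
          (map r (1 : L →ₗ⁅K⁆ L) : SExpansion 𝒮 L →ₗ[K] SExpansion 𝒯 L) := by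
      refine linearMap_ext fun s x => ?_
      rw [LinearMap.comp_apply, LieHom.coe_toLinearMap, map_tmul, lift_tmul,
        killingForm_tmul_tmul, LinearMap.smul_apply, smul_eq_mul, htr]
      rfl
    rw [heq, LinearMap.comp_apply, LieHom.coe_toLinearMap, hf, map_zero]

end Killing

/-! ### Existence for `𝒮 ⊗ S`, and conclusion. -/

theorem exists_isLeviDecomposition_ofSubalgebra {K L : Type*} (𝒮 : Type*) [Field K] [CharZero K]
    [CommSemigroup 𝒮] [Finite 𝒮] [LieRing L] [LieAlgebra K L] [FiniteDimensional K L]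
    (S : LieSubalgebra K L) [LieAlgebra.IsKilling K S] :
    ∃ (N : LieIdeal K (ofSubalgebra 𝒮 S)) (B : LieSubalgebra K (ofSubalgebra 𝒮 S)),
      IsLeviDecomposition N B := by
  obtain ⟨r, hrr, hreg, hfix⟩ := CommSemigroup.exists_regular_retraction 𝒮
  let q : 𝒮 →ₙ* r.srange := r.srangeRestrict
  let i : r.srange →ₙ* 𝒮 := MulMemClass.subtype r.srange
  have hqi : ∀ s, q (i s) = s := by
    rintro ⟨_, s, rfl⟩
    exact Subtype.ext (hrr s)
  have hKilling : LieAlgebra.IsKilling K (SExpansion r.srange S) := by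
    refine isKilling_of_regular ?_
    rintro ⟨_, s, rfl⟩
    obtain ⟨u, hu⟩ := hreg s
    refine ⟨q u, Subtype.ext ?_⟩
    rw [map_mul, map_mul] at hu
    exact hu
  let e : SExpansion 𝒮 S ≃ₗ⁅K⁆ ofSubalgebra 𝒮 S := equivOfSubalgebra S
  -- `p` and `j` are the retraction onto the regular part and its section, transported to the
  -- subalgebra along `e`.
  let p : ofSubalgebra 𝒮 S →ₗ⁅K⁆ SExpansion r.srange S :=
    (map q (1 : S →ₗ⁅K⁆ S)).comp (e.symm : ofSubalgebra 𝒮 S →ₗ⁅K⁆ SExpansion 𝒮 S)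
  let j : SExpansion r.srange S →ₗ⁅K⁆ ofSubalgebra 𝒮 S :=
    (e : SExpansion 𝒮 S →ₗ⁅K⁆ ofSubalgebra 𝒮 S).comp (map i (1 : S →ₗ⁅K⁆ S))
  have hmap : ∀ f, map q (1 : S →ₗ⁅K⁆ S) (map i (1 : S →ₗ⁅K⁆ S) f) = f := by
    intro f
    induction f using SExpansion.induction with
    | h0 => simp only [map_zero]
    | hadd f g hf hg => rw [map_add, map_add, hf, hg]
    | hs α x =>
      rw [map_tmul, map_tmul, hqi]
      rfl
  have hpj : ∀ f, p (j f) = f := fun f =>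
    (congrArg (map q (1 : S →ₗ⁅K⁆ S)) (e.symm_apply_apply _)).trans (hmap f)
  refine ⟨p.ker, j.range, IsLeviDecomposition.of_retraction p j hpj ?_⟩
  have hker : p.ker = (map q (1 : S →ₗ⁅K⁆ S)).ker.comap
      (e.symm : ofSubalgebra 𝒮 S →ₗ⁅K⁆ SExpansion 𝒮 S) := by
    ext f
    rw [LieIdeal.mem_comap, LieHom.mem_ker, LieHom.mem_ker]
    rfl
  rw [hker]
  refine LieIdeal.isSolvable_comap _ ?_ _ (isSolvable_ker_map_of_retraction q i hfix hqi)
  rw [(LieHom.ker_eq_bot _).mpr e.symm.injective]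
  infer_instance

end

end SExpansion

theorem theorem4 {K 𝒮 G : Type*} [Field K] [CharZero K] [CommSemigroup 𝒮] [Finite 𝒮]
    [LieRing G] [LieAlgebra K G] [FiniteDimensional K G]
    (N : LieIdeal K G) (S : LieSubalgebra K G) (hG : IsLeviDecomposition N S) :
    -- `E_N = 𝒮 ⊗ N`, `E_S = 𝒮 ⊗ S` and `G_𝒮 = E_N ⊎ E_S`
    IsSemidirectSum ⊤ (SExpansion.ofSubalgebra 𝒮 N.toLieSubalgebra)
      (SExpansion.ofSubalgebra 𝒮 S) ∧
    -- `E_S` has a Levi–Malcev decomposition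
    (∃ (N' : LieIdeal K (SExpansion.ofSubalgebra 𝒮 S))
      (Sexp : LieSubalgebra K (SExpansion.ofSubalgebra 𝒮 S)), IsLeviDecomposition N' Sexp) ∧
    -- for every one, `E_S = N' ⊎ S_exp`, the radical is `N_exp = E_N ⊎ N'` and `G_𝒮 = N_exp ⊎ S_exp`
    ∀ (N' : LieIdeal K (SExpansion.ofSubalgebra 𝒮 S))
      (Sexp : LieSubalgebra K (SExpansion.ofSubalgebra 𝒮 S)), IsLeviDecomposition N' Sexp →
      ∃ Nexp : LieIdeal K (SExpansion 𝒮 G),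
        IsSemidirectSum Nexp.toLieSubalgebra (SExpansion.ofSubalgebra 𝒮 N.toLieSubalgebra)
          (N'.toLieSubalgebra.map (SExpansion.ofSubalgebra 𝒮 S).incl) ∧
        Nexp = LieAlgebra.radical K (SExpansion 𝒮 G) ∧
        IsLeviDecomposition Nexp (Sexp.map (SExpansion.ofSubalgebra 𝒮 S).incl) := by
  have hsum := SExpansion.isSemidirectSum_ofSubalgebra (𝒮 := 𝒮) hG.semidirect
  have := hG.semisimple
  refine ⟨hsum, SExpansion.exists_isLeviDecomposition_ofSubalgebra 𝒮 S, fun N' Sexp h => ?_⟩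
  have hN : LieAlgebra.IsSolvable N := hG.eq_radical ▸ LieAlgebra.radicalIsSolvable K G
  -- `ofIdeal 𝒮 N` and `ofSubalgebra 𝒮 N.toLieSubalgebra` have the same elements by definition, so
  -- `hsum` applies to the ideal.
  obtain ⟨h₁, h₂⟩ := IsSemidirectSum.extend_levi (I := SExpansion.ofIdeal 𝒮 N) hsum
    (SExpansion.isSolvable_ofIdeal hN) h
  exact ⟨LieAlgebra.radical K (SExpansion 𝒮 G), h₁, rfl, h₂⟩
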